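/- Let $X$ be a smooth $d$-dimensional manifold (without boundary, Polish), let $Y$ be a Polish space, and let $\mu$ and $\nu$ be Borel probability measures on $X$ and $Y$. Let $c\colon X\times Y\to[0,\infty)$ be continuous and such that - $c(\cdot,y)$ is differentiable on $X$ for every $y\in Y$; - $c(\cdot,y)$ is locally Lipschitz uniformly in $y\in Y$, i.e. for every chart $\varphi$ of the atlas of $X$ and every $v\in\mathrm{range}\,\varphi$ there are a neighbourhood $V\subset\mathrm{range}\,\varphi$ of $v$ and a constant $K\ge 0$ such that $w\mapsto c(\varphi^{-1}(w),y)$ is $K$-Lipschitz on $V$ for all $y\in Y$; - $T_c(\mu,\nu)=\inf_{\pi\in\mathcal C(\mu,\nu)}\int c\,\mathrm d\pi<\infty$, where $\mathcal C(\mu,\nu)$ is the set of probability measures on $X\times Y$ with marginals $\mu$ and $\nu$. A $\pi\in\mathcal C(\mu,\nu)$ that attains the infimum is called an optimal plan. For $g\colon Y\to\mathbb R\cup\{-\infty\}$ put $g^c(x)=\inf_{y\in Y}\,(c(x,y)-g(y))$, and for $f\colon X\to\mathbb R\cup\{-\infty\}$ put $f^c(y)=\inf_{x\in X}\,(c(x,y)-f(x))$.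 A function $f\colon X\to\mathbb R\cup\{-\infty\}$ is $c$-concave if it is not identically $-\infty$ and $f=g^c$ for some $g\colon Y\to\mathbb R\cup\{-\infty\}$. A (generalized) Kantorovich potential is a $c$-concave $f$ for which there is an optimal plan $\pi$ with $$T_c(\mu,\nu)=\int c\,\mathrm d\pi=\int \big(f(x)+f^c(y)\big)\,\mathrm d\pi(x,y);$$ neither $f$ nor $f^c$ has to be integrable by itself. Suppose that $M=\mathrm{int}(\mathrm{supp}\,\mu)$ is connected, that $\mathrm{cl}(M)=\mathrm{supp}\,\mu$, and that, for every chart $\varphi$ of $M$ (obtained by restricting a chart of the atlas of $X$ to $M$), Lebesgue measure on $\mathrm{range}\,\varphi$ is absolutely continuous with respect to the push-forward $\varphi_\#\mu=\mu\circ\varphi^{-1}$. Then the Kantorovich potentials are almost surely unique up to constant shifts: for any two Kantorovich potentials $f_1,f_2$ there is a constant $a\in\mathbb R$ such that $f_1-f_2=a$ holds $\mu$-almost surely. -/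

import Mathlib

open MeasureTheory Set Topology
open scoped Manifold ContDiff NNReal ENNReal

noncomputable section

namespace OptimalTransport

section Transform

variable {X Y : Type*}

/-- The `c`-transform `g^c(x) = inf_y (c(x, y) - g(y))` of a function `g` on the second space.
Functions with values in `ℝ ∪ {-∞}` are modelled as `EReal`-valued functions that avoid `⊤`. -/
def cTransform (c : X → Y → ℝ) (g : Y → EReal) (x : X) : EReal :=
  ⨅ y, ((c x y : EReal) - g y)

/-- The `c`-transform `f^c(y) = inf_x (c(x, y) - f(x))` of a function `f` on the first space. -/
def cTransform' (c : X → Y → ℝ) (f : X → EReal) (y : Y) : EReal :=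
  ⨅ x, ((c x y : EReal) - f x)

/-- `f : X → ℝ ∪ {-∞}` is `c`-concave on `X`: it is the `c`-transform of some
`g : Y → ℝ ∪ {-∞}`, and it is not equal to `-∞` everywhere. -/
structure IsCConcave (c : X → Y → ℝ) (f : X → EReal) : Prop where
  ne_top : ∀ x, f x ≠ ⊤
  exists_ne_bot : ∃ x, f x ≠ ⊥
  exists_eq : ∃ g : Y → EReal, (∀ y, g y ≠ ⊤) ∧ f = cTransform c g

end Transform

section Transport

variable {X Y : Type*} [MeasurableSpace X] [MeasurableSpace Y]

/-- `π` is a transport plan between `μ` and `ν`: its marginals are `μ` and `ν`. -/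
def IsCoupling (μ : Measure X) (ν : Measure Y) (π : Measure (X × Y)) : Prop :=
  π.map Prod.fst = μ ∧ π.map Prod.snd = ν

/-- The cost `π c = ∫ c dπ ∈ [0, ∞]` of a plan, for a non-negative cost function `c`. -/
def planCost (c : X → Y → ℝ) (π : Measure (X × Y)) : ℝ≥0∞ :=
  ∫⁻ p, ENNReal.ofReal (c p.1 p.2) ∂π

/-- The optimal transport cost `T_c(μ, ν) ∈ [0, ∞]`. -/
def transportCost (c : X → Y → ℝ) (μ : Measure X) (ν : Measure Y) : ℝ≥0∞ :=
  ⨅ (π : Measure (X × Y)) (_ : IsCoupling μ ν π), planCost c π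

/-- `π` is an optimal transport plan. -/
def IsOptimalPlan (c : X → Y → ℝ) (μ : Measure X) (ν : Measure Y)
    (π : Measure (X × Y)) : Prop :=
  IsCoupling μ ν π ∧ planCost c π = transportCost c μ ν

/-- The integral of an extended real valued function, `∫ F⁺ dπ - ∫ F⁻ dπ`. Below it is only used
for functions `F` that are bounded above by an integrable function, so that the difference
is never of the form `∞ - ∞`. -/
def erealIntegral {Z : Type*} [MeasurableSpace Z] (π : Measure Z) (F : Z → EReal) : EReal :=
  ((∫⁻ z, (F z).toENNReal ∂π : ℝ≥0∞) : EReal) - ((∫⁻ z, (-F z).toENNReal ∂π : ℝ≥0∞) : EReal)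

/-- `f` is a (generalized) Kantorovich potential: `f` is `c`-concave, and there is an optimal
plan `π` with `T_c(μ, ν) = π c = π (f ⊕ f^c)`. Neither `f` nor `f^c` has to be integrable. -/
def IsKantorovichPotential (c : X → Y → ℝ) (μ : Measure X) (ν : Measure Y)
    (f : X → EReal) : Prop :=
  IsCConcave c f ∧ ∃ π : Measure (X × Y), IsOptimalPlan c μ ν π ∧
    erealIntegral π (fun p => f p.1 + cTransform' c f p.2) = (transportCost c μ ν : EReal)

/-- The Kantorovich potentials are almost surely unique (up to constant shifts): the difference
of any two of them is `μ`-almost surely equal to a real constant. (In `EReal`, a difference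
`f₁ x - f₂ x` with `f₁ x, f₂ x ≠ ⊤` is a real number only if both values are real.) -/
def PotentialsAlmostSurelyUnique (c : X → Y → ℝ) (μ : Measure X) (ν : Measure Y) : Prop :=
  ∀ f₁ f₂ : X → EReal, IsKantorovichPotential c μ ν f₁ → IsKantorovichPotential c μ ν f₂ →
    ∃ a : ℝ, ∀ᵐ x ∂μ, f₁ x - f₂ x = (a : EReal)

end Transport

section Charts

variable {X Y : Type*} [TopologicalSpace X]

/-- The functions `c(·, y)` on a `d`-dimensional manifold are locally Lipschitz uniformly in `y`:
in every chart of the atlas they are locally Lipschitz, with neighbourhoods and constants that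
do not depend on `y`. -/
def LocallyLipschitzUniformly (d : ℕ) [ChartedSpace (EuclideanSpace ℝ (Fin d)) X]
    (c : X → Y → ℝ) : Prop :=
  ∀ φ ∈ atlas (EuclideanSpace ℝ (Fin d)) X, ∀ v ∈ φ.target,
    ∃ K : ℝ≥0, ∃ V ∈ 𝓝 v, V ⊆ φ.target ∧
      ∀ y, LipschitzOnWith K (fun w => c (φ.symm w) y) V

/-- In every chart `φ` of the open subset `M` (obtained by restricting a chart of the atlas of
`X` to `M`), Lebesgue measure on the range of `φ` is absolutely continuous with respect to the
push-forward of `μ` under `φ`. -/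
def LebesgueAbsolutelyContinuousInCharts (d : ℕ)
    [ChartedSpace (EuclideanSpace ℝ (Fin d)) X] [MeasurableSpace X]
    (μ : Measure X) (M : Set X) : Prop :=
  ∀ φ ∈ atlas (EuclideanSpace ℝ (Fin d)) X,
    (volume : Measure (EuclideanSpace ℝ (Fin d))).restrict (φ '' (φ.source ∩ M)) ≪
      (μ.restrict (φ.source ∩ M)).map φ

end Charts

end OptimalTransport

end

/-! Fix one optimal plan `π`. The contact equality `f ⊕ f^c = c` holds `π`-almost surely for both
potentials, even if each was certified by a different plan (`ae_add_eq_of_ae_add_eq`). Hence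
`μ`-almost every `x` has a single partner `y` that is a contact point for both. There `c(·, y) - fᵢ`
is minimal at `x`, so both gradients, where they exist, equal that of `c(·, y)` and therefore each
other.

The uniform Lipschitz bound on `c` passes to infima over `y`: each `fᵢ` is locally Lipschitz on a
clopen set and `-∞` off it. This set contains the connected set `M`. In charts, Rademacher's theorem
gives differentiability Lebesgue-a.e., and absolute continuity of Lebesgue measure with respect to
the push-forward of `μ` turns "`μ`-a.e. contact" into "Lebesgue-a.e. contact". So `f₁ - f₂` is
locally Lipschitz with zero gradient a.e., hence locally constant on `M`, constant by connectedness,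
and constant on `closure M = supp μ` by continuity. -/

/-! ### Lipschitz functions with almost everywhere vanishing derivative -/

/-- A real function that is Lipschitz on a segment, with almost everywhere vanishing derivative
on it, has equal values at the end points. -/
theorem LipschitzWith.eq_add_of_ae_fderiv_eq_zero {E : Type*} [NormedAddCommGroup E]
    [NormedSpace ℝ E] {h : E → ℝ} {K : ℝ≥0} (hh : LipschitzWith K h) {B : Set E}
    (hB : Convex ℝ B) {x v : E} (hx : x ∈ B) (hxv : x + v ∈ B)
    (hd : ∀ᵐ t : ℝ, x + t • v ∈ B → HasFDerivAt h (0 : E →L[ℝ] ℝ) (x + t • v)) :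
    h (x + v) = h x := by
  have hline : ∀ t : ℝ, HasDerivAt (fun t : ℝ => x + t • v) v t := fun t => by
    simpa using ((hasDerivAt_id t).smul_const v).const_add x
  have hlip : LipschitzWith (K * ‖v‖₊) (fun t : ℝ => h (x + t • v)) := by
    refine hh.comp (LipschitzWith.of_dist_le_mul fun s t => ?_)
    rw [dist_add_left, dist_eq_norm, ← sub_smul, norm_smul, dist_eq_norm, mul_comm]
    rfl
  obtain ⟨C, hC⟩ := (hlip.lipschitzOnWith (s := uIcc 0 1)).absolutelyContinuousOnInterval
    |>.const_of_ae_hasDerivAt_zero (by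
      filter_upwards [hd] with t ht ht01
      have hmem : x + t • v ∈ B := by
        rw [uIcc_of_le zero_le_one] at ht01
        have := hB hx hxv (sub_nonneg.2 ht01.2) ht01.1 (by ring)
        convert this using 1
        module
      have h2 := (ht hmem).comp_hasDerivAt t (hline t)
      rwa [zero_apply] at h2)
  have h0 := hC (x := 0) (by simp)
  have h1 := hC (x := 1) (by simp)
  simp only [zero_smul, add_zero, one_smul] at h0 h1
  rw [h0, h1]

/-- A function that is Lipschitz on an open convex set, with almost everywhere vanishing
derivative, is constant there. -/
theorem LipschitzOnWith.eq_of_ae_fderiv_eq_zero {E : Type*} [NormedAddCommGroup E]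
    [NormedSpace ℝ E] [FiniteDimensional ℝ E] [MeasurableSpace E] [BorelSpace E]
    (ρ : Measure E) [ρ.IsAddHaarMeasure] {h : E → ℝ} {K : ℝ≥0} {B : Set E}
    (hh : LipschitzOnWith K h B) (hB : Convex ℝ B) (hBo : IsOpen B)
    (hd : ∀ᵐ x ∂ρ, x ∈ B → HasFDerivAt h (0 : E →L[ℝ] ℝ) x) {x y : E} (hx : x ∈ B)
    (hy : y ∈ B) : h x = h y := by
  obtain ⟨h', hlip, heq⟩ := hh.extend_real
  have hd' : ∀ᵐ x ∂ρ, x ∈ B → HasFDerivAt h' (0 : E →L[ℝ] ℝ) x := by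
    filter_upwards [hd] with x hx hxB
    exact (hx hxB).congr_of_eventuallyEq
      (Filter.eventually_of_mem (hBo.mem_nhds hxB) fun z hz => (heq hz).symm)
  -- The good set need not be measurable, so it is shrunk to a measurable set of full measure to
  -- allow Fubini.
  set s : Set E := (toMeasurable ρ {x | x ∈ B → HasFDerivAt h' (0 : E →L[ℝ] ℝ) x}ᶜ)ᶜ with hs
  have hsm : MeasurableSet s := (measurableSet_toMeasurable _ _).compl
  have hsub : ∀ z ∈ s, z ∈ B → HasFDerivAt h' (0 : E →L[ℝ] ℝ) z := fun z hz => by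
    by_contra hcon
    exact hz (subset_toMeasurable _ _ hcon)
  have hsae : s ∈ ae ρ := mem_ae_iff.2 (by rw [hs, compl_compl, measure_toMeasurable]; exact hd')
  set v := y - x with hv
  -- Fubini along the direction `v`: for almost every base point `z`, the line `z + t • v` meets the
  -- exceptional set in a null set of `t`.
  have key := (ae_ae_add_linearMap_mem_iff (LinearMap.toSpanSingleton ℝ E v)
    (volume : Measure ℝ) ρ hsm).2 hsae
  have hU : IsOpen (B ∩ (fun z => z + v) ⁻¹' B) := 
    hBo.inter (hBo.preimage (continuous_id.add continuous_const))
  have hxU : x ∈ B ∩ (fun z => z + v) ⁻¹' B := ⟨hx, by simpa [hv] using hy⟩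
  -- The line through `x` itself may be bad, but good base points are dense; continuity then
  -- transfers the equality to `x`.
  have hcl : x ∈ closure {z | z ∈ B ∩ (fun z => z + v) ⁻¹' B → h' (z + v) = h' z} := by
    refine (Measure.dense_of_ae (μ := ρ) ?_) x
    filter_upwards [key] with z hz hzU
    refine hlip.eq_add_of_ae_fderiv_eq_zero hB hzU.1 hzU.2 ?_
    filter_upwards [hz] with t ht using hsub _ ht
  have hclosed : IsClosed {z | h' (z + v) = h' z} :=
    isClosed_eq (hlip.continuous.comp (continuous_id.add continuous_const)) hlip.continuous
  have : x ∈ {z | h' (z + v) = h' z} := by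
    rw [← hclosed.closure_eq]
    refine closure_mono ?_ (hU.inter_closure ⟨hxU, hcl⟩)
    exact fun z hz => hz.2 hz.1
  rw [heq hx, heq hy, ← (this : h' (x + v) = h' x), hv, add_sub_cancel]

namespace OptimalTransport

/-! ### Truncation of real numbers -/

section Clamp

/-- Truncation of a real number to `[-n, n]`. -/
def clamp (n : ℕ) (t : ℝ) : ℝ := max (-n) (min t n)

theorem abs_clamp_le (n : ℕ) (t : ℝ) : |clamp n t| ≤ n := by
  have hn : (0 : ℝ) ≤ n := n.cast_nonneg
  exact abs_le.2 ⟨le_max_left _ _, max_le (by linarith) (min_le_right _ _)⟩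

theorem measurable_clamp (n : ℕ) : Measurable (clamp n) :=
  measurable_const.max (measurable_id.min measurable_const)

/-- Truncation is odd, monotone and 1-Lipschitz, so `clamp n a - clamp n (-b)` lies between `0` and
`a + b`. This is what keeps truncated potentials below a nonnegative cost. -/
theorem clamp_add_clamp_le (n : ℕ) (a b : ℝ) : clamp n a + clamp n b ≤ max (a + b) 0 := by
  have hn : (0 : ℝ) ≤ n := n.cast_nonneg
  unfold clamp
  rcases max_cases (-(n : ℝ)) (min a n) with h1 | h1 <;>
  rcases max_cases (-(n : ℝ)) (min b n) with h2 | h2 <;>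
  rcases min_cases a (n : ℝ) with h3 | h3 <;>
  rcases min_cases b (n : ℝ) with h4 | h4 <;>
  rcases max_cases (a + b) 0 with h5 | h5 <;> linarith

theorem clamp_neg (n : ℕ) (t : ℝ) : clamp n (-t) = -clamp n t := by
  have hn : (0 : ℝ) ≤ n := n.cast_nonneg
  unfold clamp
  rcases max_cases (-(n : ℝ)) (min t n) with h1 | h1 <;>
  rcases max_cases (-(n : ℝ)) (min (-t) n) with h2 | h2 <;>
  rcases min_cases t (n : ℝ) with h3 | h3 <;>
  rcases min_cases (-t) (n : ℝ) with h4 | h4 <;> linarith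

theorem abs_clamp_add_clamp_le (n : ℕ) (a b : ℝ) : |clamp n a + clamp n b| ≤ |a + b| := by
  have h1 := clamp_add_clamp_le n a b
  have h2 := clamp_add_clamp_le n (-a) (-b)
  rw [clamp_neg, clamp_neg] at h2
  have h3 : max (a + b) 0 ≤ |a + b| := max_le (le_abs_self _) (abs_nonneg _)
  have h4 : max (-a + -b) 0 ≤ |a + b| :=
    max_le (by rw [← neg_add]; exact neg_le_abs _) (abs_nonneg _)
  exact abs_le.2 ⟨by linarith, by linarith⟩

theorem tendsto_clamp (t : ℝ) :
    Filter.Tendsto (fun n : ℕ => clamp n t) Filter.atTop (𝓝 t) := by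
  refine tendsto_const_nhds.congr' ?_
  filter_upwards [Filter.eventually_ge_atTop ⌈|t|⌉₊] with n hn
  have := abs_le.1 ((Nat.le_ceil _).trans (Nat.cast_le.2 hn : ((⌈|t|⌉₊ : ℕ) : ℝ) ≤ n))
  rw [clamp, min_eq_left this.2, max_eq_right this.1]

end Clamp

/-! ### Transfer of the contact equality between optimal plans -/

section Coupling

variable {X Y : Type*} [MeasurableSpace X] [MeasurableSpace Y]

theorem IsCoupling.isProbabilityMeasure {μ : Measure X} [IsProbabilityMeasure μ] {ν : Measure Y}
    {π : Measure (X × Y)} (h : IsCoupling μ ν π) : IsProbabilityMeasure π := by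
  have : IsProbabilityMeasure (π.map Prod.fst) := by rw [h.1]; infer_instance
  exact Measure.isProbabilityMeasure_of_map Prod.fst

theorem IsCoupling.ae_fst {μ : Measure X} {ν : Measure Y} {π : Measure (X × Y)}
    (h : IsCoupling μ ν π) {p : X → Prop} (hp : ∀ᵐ x ∂μ, p x) : ∀ᵐ z ∂π, p z.1 := by
  rw [← h.1] at hp
  exact ae_of_ae_map measurable_fst.aemeasurable hp

theorem IsCoupling.ae_snd {μ : Measure X} {ν : Measure Y} {π : Measure (X × Y)}
    (h : IsCoupling μ ν π) {p : Y → Prop} (hp : ∀ᵐ y ∂ν, p y) : ∀ᵐ z ∂π, p z.2 := by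
  rw [← h.2] at hp
  exact ae_of_ae_map measurable_snd.aemeasurable hp

/-- If `u ⊕ v = c` holds almost surely for one optimal plan and `u ⊕ v ≤ c` for another one, then
equality holds for the other plan as well, even if neither `u` nor `v` is integrable. -/
theorem ae_add_eq_of_ae_add_eq {μ : Measure X} [IsProbabilityMeasure μ] {ν : Measure Y}
    {π π' : Measure (X × Y)} (hπ : IsCoupling μ ν π) (hπ' : IsCoupling μ ν π')
    {c : X × Y → ℝ} (hc : Measurable c) (hc0 : ∀ z, 0 ≤ c z)
    (hcost : ∫⁻ z, ENNReal.ofReal (c z) ∂π = ∫⁻ z, ENNReal.ofReal (c z) ∂π')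
    (hfin : ∫⁻ z, ENNReal.ofReal (c z) ∂π < ⊤)
    {u : X → ℝ} {v : Y → ℝ} (hu : Measurable u) (hv : Measurable v)
    (heq : ∀ᵐ z ∂π, u z.1 + v z.2 = c z) (hle : ∀ᵐ z ∂π', u z.1 + v z.2 ≤ c z) :
    ∀ᵐ z ∂π', u z.1 + v z.2 = c z := by
  have := hπ.isProbabilityMeasure
  have := hπ'.isProbabilityMeasure
  have hint : Integrable c π := ⟨hc.aestronglyMeasurable, by
    rw [hasFiniteIntegral_iff_ofReal (.of_forall hc0)]; exact hfin⟩
  have hint' : Integrable c π' := ⟨hc.aestronglyMeasurable, by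
    rw [hasFiniteIntegral_iff_ofReal (.of_forall hc0), ← hcost]; exact hfin⟩
  have hcc : ∫ z, c z ∂π = ∫ z, c z ∂π' := by
    rw [integral_eq_lintegral_of_nonneg_ae (.of_forall hc0) hc.aestronglyMeasurable,
      integral_eq_lintegral_of_nonneg_ae (.of_forall hc0) hc.aestronglyMeasurable, hcost]
  let ξ : ℕ → X × Y → ℝ := fun n z => clamp n (u z.1) + clamp n (v z.2)
  have hm1 : ∀ n, Measurable fun z : X × Y => clamp n (u z.1) := fun n =>
    (measurable_clamp n).comp (hu.comp measurable_fst)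
  have hm2 : ∀ n, Measurable fun z : X × Y => clamp n (v z.2) := fun n =>
    (measurable_clamp n).comp (hv.comp measurable_snd)
  have hi1 : ∀ (ρ : Measure (X × Y)) [IsProbabilityMeasure ρ] n,
      Integrable (fun z : X × Y => clamp n (u z.1)) ρ := fun ρ _ n =>
    .of_bound (hm1 n).aestronglyMeasurable n (.of_forall fun z => abs_clamp_le n _)
  have hi2 : ∀ (ρ : Measure (X × Y)) [IsProbabilityMeasure ρ] n,
      Integrable (fun z : X × Y => clamp n (v z.2)) ρ := fun ρ _ n =>
    .of_bound (hm2 n).aestronglyMeasurable n (.of_forall fun z => abs_clamp_le n _)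
  have hiξ : ∀ (ρ : Measure (X × Y)) [IsProbabilityMeasure ρ] n, Integrable (ξ n) ρ := fun ρ _ n =>
    (hi1 ρ n).add (hi2 ρ n)
  -- Truncated functions are bounded, so their integrals split and depend only on the marginals:
  -- both plans give the same value.
  have hsplit : ∀ ρ : Measure (X × Y), IsProbabilityMeasure ρ → IsCoupling μ ν ρ → ∀ n,
      ∫ z, ξ n z ∂ρ = ∫ x, clamp n (u x) ∂μ + ∫ y, clamp n (v y) ∂ν := fun ρ _ hρ n => by
    have h1 : ∫ x, clamp n (u x) ∂μ = ∫ z, clamp n (u z.1) ∂ρ := by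
      rw [← hρ.1]
      exact integral_map measurable_fst.aemeasurable
        ((measurable_clamp n).comp hu).aestronglyMeasurable
    have h2 : ∫ y, clamp n (v y) ∂ν = ∫ z, clamp n (v z.2) ∂ρ := by
      rw [← hρ.2]
      exact integral_map measurable_snd.aemeasurable
        ((measurable_clamp n).comp hv).aestronglyMeasurable
    rw [h1, h2]
    exact integral_add (hi1 ρ n) (hi2 ρ n)
  have hξlim : ∀ z, Filter.Tendsto (fun n => ξ n z) Filter.atTop (𝓝 (u z.1 + v z.2)) :=
    fun z => (tendsto_clamp _).add (tendsto_clamp _)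
  -- Dominated convergence with bound `c`: `|ξ n| ≤ |u + v| = c` holds `π`-almost surely.
  have hlim : Filter.Tendsto (fun n => ∫ z, ξ n z ∂π) Filter.atTop (𝓝 (∫ z, c z ∂π)) := by
    refine tendsto_integral_of_dominated_convergence c
      (fun n => ((hm1 n).add (hm2 n)).aestronglyMeasurable) hint (fun n => ?_) ?_
    · filter_upwards [heq] with z hz
      refine (abs_clamp_add_clamp_le n _ _).trans ?_
      rw [hz, abs_of_nonneg (hc0 z)]
    · filter_upwards [heq] with z hz
      rw [← hz]
      exact hξlim z
  have hlim' : Filter.Tendsto (fun n => ENNReal.ofReal (∫ z, (c z - ξ n z) ∂π')) Filter.atTop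
      (𝓝 0) := by
    have : ∀ n, ∫ z, (c z - ξ n z) ∂π' = ∫ z, c z ∂π - ∫ z, ξ n z ∂π := fun n => by
      rw [integral_sub hint' (hiξ π' n), hcc, hsplit π ‹_› hπ,
        hsplit π' ‹_› hπ']
    simp_rw [this]
    have h := ENNReal.tendsto_ofReal (hlim.const_sub (∫ z, c z ∂π))
    rwa [sub_self, ENNReal.ofReal_zero] at h
  have hξle : ∀ n, ∀ᵐ z ∂π', 0 ≤ c z - ξ n z := fun n => by
    filter_upwards [hle] with z hz
    have := clamp_add_clamp_le n (u z.1) (v z.2)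
    have h2 : max (u z.1 + v z.2) 0 ≤ c z := max_le hz (hc0 z)
    simp only [ξ]
    linarith
  -- Fatou for the nonnegative gaps `c - ξ n`, whose `π'`-integrals tend to `0`; no integrability of
  -- `u` or `v` is needed.
  have hfatou : ∫⁻ z, ENNReal.ofReal (c z - (u z.1 + v z.2)) ∂π' ≤ 0 := by
    calc ∫⁻ z, ENNReal.ofReal (c z - (u z.1 + v z.2)) ∂π'
        = ∫⁻ z, Filter.liminf (fun n => ENNReal.ofReal (c z - ξ n z)) Filter.atTop ∂π' := by
          refine lintegral_congr fun z => ?_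
          exact ((ENNReal.continuous_ofReal.tendsto _).comp
            ((hξlim z).const_sub (c z))).liminf_eq.symm
      _ ≤ Filter.liminf (fun n => ∫⁻ z, ENNReal.ofReal (c z - ξ n z) ∂π') Filter.atTop :=
          lintegral_liminf_le fun n => (hc.sub ((hm1 n).add (hm2 n))).ennreal_ofReal
      _ = Filter.liminf (fun n => ENNReal.ofReal (∫ z, (c z - ξ n z) ∂π')) Filter.atTop := by
          congr 1
          funext n
          exact (ofReal_integral_eq_lintegral_ofReal (hint'.sub (hiξ π' n)) (hξle n)).symm
      _ = 0 := hlim'.liminf_eq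
  have hmeas : Measurable fun z : X × Y => ENNReal.ofReal (c z - (u z.1 + v z.2)) :=
    (hc.sub ((hu.comp measurable_fst).add (hv.comp measurable_snd))).ennreal_ofReal
  have h0 := (lintegral_eq_zero_iff hmeas).1 (le_antisymm hfatou bot_le)
  filter_upwards [h0, hle] with z hz hz'
  have : c z - (u z.1 + v z.2) ≤ 0 := ENNReal.ofReal_eq_zero.1 hz
  linarith

end Coupling

end OptimalTransport

namespace OptimalTransport

/-! ### Pointwise properties of `c`-transforms -/

section Transform

variable {X Y : Type*} {c : X → Y → ℝ}

theorem cTransform'_ne_top {f : X → EReal} (hf : ∃ x, f x ≠ ⊥) (y : Y) :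
    cTransform' c f y ≠ ⊤ := by
  obtain ⟨x, hx⟩ := hf
  refine ne_top_of_le_ne_top ?_ (iInf_le _ x)
  induction h : f x with
  | bot => exact absurd h hx
  | top => simp
  | coe r => exact EReal.coe_ne_top (c x y - r)

theorem add_cTransform'_le {f : X → EReal} {x : X} (hx : f x ≠ ⊤) (y : Y) :
    f x + cTransform' c f y ≤ c x y := by
  have h : cTransform' c f y ≤ (c x y : EReal) - f x := iInf_le _ x
  rw [add_comm]
  by_cases hb : f x = ⊥
  · simp [hb]
  · exact (EReal.le_sub_iff_add_le (.inl hb) (.inl hx)).1 h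

theorem toReal_add_toReal_le {f : X → EReal} {x : X} {y : Y} (hx : f x ≠ ⊤) (hx' : f x ≠ ⊥)
    (hy : cTransform' c f y ≠ ⊥) : (f x).toReal + (cTransform' c f y).toReal ≤ c x y := by
  have h := add_cTransform'_le (c := c) hx y
  have hy' := cTransform'_ne_top (c := c) ⟨x, hx'⟩ y
  rw [← EReal.coe_toReal hx hx', ← EReal.coe_toReal hy' hy] at h
  exact_mod_cast h

/-- A modulus of continuity in `x` that is uniform in `y` survives the infimum, whatever `g` is and
including infinite values. -/
theorem cTransform_le_add {g : Y → EReal} {x x' : X} {r : ℝ}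
    (h : ∀ y, c x y ≤ c x' y + r) : cTransform c g x ≤ cTransform c g x' + r := by
  have hr : (r : EReal) ≠ ⊥ := EReal.coe_ne_bot r
  have hr' : (r : EReal) ≠ ⊤ := EReal.coe_ne_top r
  rw [← EReal.sub_le_iff_le_add (.inl hr) (.inl hr')]
  refine le_iInf fun y => ?_
  rw [EReal.sub_le_iff_le_add (.inl hr) (.inl hr')]
  refine (iInf_le _ y).trans ?_
  induction g y with
  | bot => simp
  | top => simp
  | coe s =>
    have := h y
    norm_cast
    linarith

/-- The index set may be uncountable, so measurability comes from upper semicontinuity of an infimum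
of continuous functions. -/
theorem measurable_iInf_coe_sub {Z ι : Type*} [TopologicalSpace Z] [MeasurableSpace Z]
    [OpensMeasurableSpace Z] {k : Z → ι → ℝ} (hk : ∀ i, Continuous fun z => k z i)
    (g : ι → EReal) : Measurable fun z => ⨅ i, ((k z i : EReal) - g i) := by
  refine UpperSemicontinuous.measurable (upperSemicontinuous_iInf fun i => ?_)
  refine Continuous.upperSemicontinuous (continuous_iff_continuousAt.2 fun z => ?_)
  simp only [sub_eq_add_neg]
  exact ContinuousAt.comp (f := fun z => ((k z i : EReal), -g i))
    (EReal.continuousAt_add (.inl (EReal.coe_ne_top _)) (.inl (EReal.coe_ne_bot _)))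
    ((continuous_coe_real_ereal.comp (hk i)).continuousAt.prodMk continuousAt_const)

end Transform

/-- Almost every point of the first space has a partner in any set of full measure for a plan. -/
theorem IsCoupling.ae_exists {X Y : Type*} [MeasurableSpace X] [MeasurableSpace Y]
    [StandardBorelSpace Y] {μ : Measure X} [IsProbabilityMeasure μ] {ν : Measure Y}
    {π : Measure (X × Y)} (hπ : IsCoupling μ ν π)
    {p : X × Y → Prop}
    (hp : ∀ᵐ z ∂π, p z) : ∀ᵐ x ∂μ, ∃ y, p (x, y) := by
  have := hπ.isProbabilityMeasure
  obtain ⟨z, -⟩ := hp.exists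
  have : Nonempty Y := ⟨z.2⟩
  -- Disintegrating over the first marginal, almost every conditional law is a probability measure
  -- giving `p` full measure, hence a witness exists.
  rw [← π.disintegrate π.condKernel, Measure.fst, hπ.1] at hp
  filter_upwards [Measure.ae_ae_of_ae_compProd hp] with x hx using hx.exists

/-! ### Contact equality for Kantorovich potentials -/

section Potential

variable {X Y : Type*} [TopologicalSpace X] [TopologicalSpace Y] {c : X → Y → ℝ}

theorem IsCConcave.measurable [MeasurableSpace X] [OpensMeasurableSpace X]
    (hc : Continuous fun p : X × Y => c p.1 p.2) {f : X → EReal}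
    (hf : IsCConcave c f) : Measurable f := by
  obtain ⟨g, -, rfl⟩ := hf.exists_eq
  exact measurable_iInf_coe_sub (fun y => hc.comp (continuous_id.prodMk continuous_const)) g

theorem measurable_cTransform' [MeasurableSpace Y] [OpensMeasurableSpace Y]
    (hc : Continuous fun p : X × Y => c p.1 p.2) (f : X → EReal) :
    Measurable (cTransform' c f) :=
  measurable_iInf_coe_sub (k := fun y x => c x y)
    (fun _ => hc.comp (continuous_const.prodMk continuous_id)) f

/-- With `P`, `N`, `T` the integrals of `F⁺`, `F⁻`, `k`: `P ≤ T < ∞` and `P - N = T` force `N = 0`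
and `P = T`, so `F ≥ 0` and `F⁺ = k` almost everywhere. -/
theorem ae_eq_of_erealIntegral_eq {Z : Type*} [MeasurableSpace Z] {π : Measure Z} {F : Z → EReal}
    {k : Z → ℝ} (hF : Measurable F) (hk : Measurable k) (hk0 : ∀ z, 0 ≤ k z)
    (hle : ∀ z, F z ≤ k z) (hfin : ∫⁻ z, ENNReal.ofReal (k z) ∂π < ⊤)
    (h : erealIntegral π F = ((∫⁻ z, ENNReal.ofReal (k z) ∂π : ℝ≥0∞) : EReal)) :
    ∀ᵐ z ∂π, F z = k z := by
  have hp : ∀ z, (F z).toENNReal ≤ ENNReal.ofReal (k z) := fun z => by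
    simpa using EReal.toENNReal_le_toENNReal (hle z)
  have hP := lintegral_mono (μ := π) hp
  unfold erealIntegral at h
  set P := ∫⁻ z, (F z).toENNReal ∂π
  set N := ∫⁻ z, (-F z).toENNReal ∂π with hN
  set T := ∫⁻ z, ENNReal.ofReal (k z) ∂π
  have hPfin : P ≠ ⊤ := (hP.trans_lt hfin).ne
  have hPT : P = T + N := by
    have hNt : N ≠ ⊤ := by
      rintro hNt
      rw [hNt] at h
      simp at h
      exact absurd h.symm (EReal.coe_ennreal_ne_bot T)
    lift P to ℝ≥0 using hPfin with P' hP'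
    lift N to ℝ≥0 using hNt with N' hN'
    lift T to ℝ≥0 using hfin.ne with T' hT'
    have h2 : (P' : ℝ) - N' = T' := by
      simp only [EReal.coe_nnreal_eq_coe_real] at h
      exact_mod_cast h
    have h3 : (P' : ℝ) = T' + N' := by linarith
    exact_mod_cast h3
  have hN0 : N = 0 := by
    by_contra hne
    exact absurd (hPT ▸ hP) (not_le.2 (ENNReal.lt_add_right hfin.ne hne))
  rw [hN0, add_zero] at hPT
  have h1 := ae_eq_of_ae_le_of_lintegral_le (.of_forall hp) hPfin hk.ennreal_ofReal.aemeasurable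
    hPT.ge
  have h2 := (lintegral_eq_zero_iff (measurable_ereal_toENNReal.comp hF.neg)).1 hN0
  filter_upwards [h1, h2] with z hz1 hz2
  have hz0 : 0 ≤ F z := by
    have : -F z ≤ 0 := EReal.toENNReal_eq_zero_iff.1 hz2
    simpa using this
  rw [← EReal.coe_toENNReal hz0, hz1, EReal.coe_ennreal_ofReal, max_eq_left (hk0 z)]

variable [MeasurableSpace X] [BorelSpace X] [PolishSpace Y] [MeasurableSpace Y]
  [BorelSpace Y] {μ : Measure X} [IsProbabilityMeasure μ] {ν : Measure Y} {f : X → EReal}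

/-- For a Kantorovich potential `f`, equality `f ⊕ f^c = c` holds almost surely for every optimal
plan. -/
theorem IsKantorovichPotential.ae_add_eq (hc0 : ∀ x y, 0 ≤ c x y)
    (hc : Continuous fun p : X × Y => c p.1 p.2) (hT : transportCost c μ ν < ⊤)
    (hf : IsKantorovichPotential c μ ν f) {π' : Measure (X × Y)} (hπ' : IsOptimalPlan c μ ν π') :
    ∀ᵐ z ∂π', f z.1 ≠ ⊥ ∧ cTransform' c f z.2 ≠ ⊥ ∧
      (f z.1).toReal + (cTransform' c f z.2).toReal = c z.1 z.2 := by
  obtain ⟨hcc, π, hπ, hint⟩ := hf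
  have hfm := hcc.measurable hc
  have hfcm := measurable_cTransform' hc f
  have heq : ∀ᵐ z ∂π, f z.1 + cTransform' c f z.2 = c z.1 z.2 := by
    rw [← hπ.2] at hint hT
    exact ae_eq_of_erealIntegral_eq (Z := X × Y) (F := fun z => f z.1 + cTransform' c f z.2)
      (k := fun z => c z.1 z.2)
      ((hfm.comp measurable_fst).add (hfcm.comp measurable_snd)) hc.measurable
      (fun z => hc0 _ _) (fun z => add_cTransform'_le (hcc.ne_top _) _) hT hint
  -- Finiteness concerns one marginal only, so it passes from `π` to `μ` and then to any other plan;
  -- the value `0` of `toReal` at `⊥` is thus harmless.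
  have hb1 : ∀ᵐ x ∂μ, f x ≠ ⊥ := by
    have hm : MeasurableSet {x | f x ≠ ⊥} := hfm (measurableSet_singleton ⊥).compl
    rw [← hπ.1.1, ae_map_iff measurable_fst.aemeasurable hm]
    filter_upwards [heq] with z hz hb
    simp [hb] at hz
  have hb2 : ∀ᵐ y ∂ν, cTransform' c f y ≠ ⊥ := by
    have hm : MeasurableSet {y | cTransform' c f y ≠ ⊥} := hfcm (measurableSet_singleton ⊥).compl
    rw [← hπ.1.2, ae_map_iff measurable_snd.aemeasurable hm]
    filter_upwards [heq] with z hz hb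
    simp [hb] at hz
  have key := ae_add_eq_of_ae_add_eq hπ.1 hπ'.1 hc.measurable (fun z => hc0 z.1 z.2)
    (hπ.2.trans hπ'.2.symm) (hπ.2.trans_lt hT) hfm.ereal_toReal hfcm.ereal_toReal ?_ ?_
  · filter_upwards [key, hπ'.1.ae_fst hb1, hπ'.1.ae_snd hb2] with z h1 h2 h3 using ⟨h2, h3, h1⟩
  · filter_upwards [heq, hπ.1.ae_fst hb1, hπ.1.ae_snd hb2] with z h1 h2 h3
    rw [← EReal.coe_toReal (hcc.ne_top _) h2,
      ← EReal.coe_toReal (cTransform'_ne_top hcc.exists_ne_bot _) h3] at h1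
    exact_mod_cast h1
  · filter_upwards [hπ'.1.ae_fst hb1, hπ'.1.ae_snd hb2] with z h2 h3
    exact toReal_add_toReal_le (hcc.ne_top _) h2 h3

end Potential

end OptimalTransport

namespace OptimalTransport

/-! ### Local regularity and comparison of potentials in charts -/

section Charts

variable {d : ℕ} {X Y : Type*} [TopologicalSpace X] [ChartedSpace (EuclideanSpace ℝ (Fin d)) X]
  {c : X → Y → ℝ}

/-- A `c`-concave function is, near every point of a chart, either Lipschitz or constantly `-∞`. -/
theorem IsCConcave.exists_lipschitzOnWith (hc : LocallyLipschitzUniformly d c) {f : X → EReal}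
    (hf : IsCConcave c f) {φ : OpenPartialHomeomorph X (EuclideanSpace ℝ (Fin d))}
    (hφ : φ ∈ atlas (EuclideanSpace ℝ (Fin d)) X) {v : EuclideanSpace ℝ (Fin d)}
    (hv : v ∈ φ.target) :
    ∃ V ∈ 𝓝 v, (∀ w ∈ V, f (φ.symm w) ≠ ⊥ ↔ f (φ.symm v) ≠ ⊥) ∧
      (f (φ.symm v) ≠ ⊥ → ∃ K, LipschitzOnWith K (fun w => (f (φ.symm w)).toReal) V) := by
  obtain ⟨K, V, hV, -, hlip⟩ := hc φ hφ v hv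
  obtain ⟨g, -, hfg⟩ := hf.exists_eq
  have hle : ∀ w ∈ V, ∀ w' ∈ V, f (φ.symm w) ≤ f (φ.symm w') + ((K * dist w w' : ℝ) : EReal) := by
    intro w hw w' hw'
    rw [hfg]
    exact cTransform_le_add fun y => (hlip y).le_add_mul hw hw'
  have hbot : ∀ w ∈ V, ∀ w' ∈ V, f (φ.symm w) ≠ ⊥ → f (φ.symm w') ≠ ⊥ := by
    intro w hw w' hw' hne hb
    have := hle w hw w' hw'
    rw [hb, EReal.bot_add, le_bot_iff] at this
    exact hne this
  have hvV := mem_of_mem_nhds hV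
  refine ⟨V, hV, fun w hw => ⟨hbot w hw v hvV, hbot v hvV w hw⟩, fun hne => ⟨K, ?_⟩⟩
  refine LipschitzOnWith.of_le_add_mul K fun w hw w' hw' => ?_
  have := hle w hw w' hw'
  rw [← EReal.coe_toReal (hf.ne_top _) (hbot v hvV w hw hne),
    ← EReal.coe_toReal (hf.ne_top _) (hbot v hvV w' hw' hne)] at this
  exact_mod_cast this

/-- Nearby values differ by a finite amount, so being finite is a locally constant property. -/
theorem IsCConcave.isClopen_ne_bot (hc : LocallyLipschitzUniformly d c) {f : X → EReal}
    (hf : IsCConcave c f) : IsClopen {x | f x ≠ ⊥} := by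
  have key : ∀ x, ∀ᶠ x' in 𝓝 x, f x' ≠ ⊥ ↔ f x ≠ ⊥ := fun x => by
    set φ := chartAt (EuclideanSpace ℝ (Fin d)) x
    have hx : x ∈ φ.source := mem_chart_source _ x
    obtain ⟨V, hV, h, -⟩ := hf.exists_lipschitzOnWith hc (chart_mem_atlas _ x) (φ.map_source hx)
    filter_upwards [(φ.continuousAt hx).preimage_mem_nhds hV, φ.open_source.mem_nhds hx]
      with x' h1 h2
    have := h _ h1
    rwa [φ.left_inv h2, φ.left_inv hx] at this
  refine ⟨⟨isOpen_iff_mem_nhds.2 fun x hx => ?_⟩, isOpen_iff_mem_nhds.2 fun x hx => ?_⟩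
  · filter_upwards [key x] with x' h using fun h' => hx (h.1 h')
  · filter_upwards [key x] with x' h using h.2 hx

theorem IsCConcave.continuousOn_toReal (hc : LocallyLipschitzUniformly d c) {f : X → EReal}
    (hf : IsCConcave c f) : ContinuousOn (fun x => (f x).toReal) {x | f x ≠ ⊥} := by
  intro x hxb
  refine ContinuousAt.continuousWithinAt ?_
  set φ := chartAt (EuclideanSpace ℝ (Fin d)) x
  have hx : x ∈ φ.source := mem_chart_source _ x
  obtain ⟨V, hV, -, h⟩ := hf.exists_lipschitzOnWith hc (chart_mem_atlas _ x) (φ.map_source hx)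
  obtain ⟨K, hK⟩ := h (by rwa [φ.left_inv hx])
  have h1 : ContinuousAt (fun x' => (f (φ.symm (φ x'))).toReal) x :=
    ContinuousAt.comp (g := fun w => (f (φ.symm w)).toReal) (hK.continuousOn.continuousAt hV)
      (φ.continuousAt hx)
  refine h1.congr ?_
  filter_upwards [φ.open_source.mem_nhds hx] with x' h2
  rw [φ.left_inv h2]

/-- Properties that hold `μ`-almost surely hold Lebesgue-almost everywhere in charts. -/
theorem LebesgueAbsolutelyContinuousInCharts.ae [MeasurableSpace X] [BorelSpace X]
    {μ : Measure X} {M : Set X} (hac : LebesgueAbsolutelyContinuousInCharts d μ M)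
    (hM : IsOpen M) {φ : OpenPartialHomeomorph X (EuclideanSpace ℝ (Fin d))}
    (hφ : φ ∈ atlas (EuclideanSpace ℝ (Fin d)) X) {p : X → Prop} (hp : ∀ᵐ x ∂μ, p x) :
    ∀ᵐ w, w ∈ φ.target → φ.symm w ∈ M → p (φ.symm w) := by
  rcases isEmpty_or_nonempty X with hX | ⟨⟨x₀⟩⟩
  · exact .of_forall fun w => hX.elim (φ.symm w)
  classical
  set N := toMeasurable μ {x | ¬ p x} with hN
  have hN0 : μ N = 0 := by rw [hN, measure_toMeasurable]; exact hp
  have hNm : MeasurableSet N := measurableSet_toMeasurable _ _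
  have hsM : IsOpen (φ.source ∩ M) := φ.open_source.inter hM
  -- The chart inverse is measurable only on the target; an arbitrary value `x₀` elsewhere makes it
  -- globally measurable.
  let g : EuclideanSpace ℝ (Fin d) → X := φ.target.piecewise φ.symm fun _ => x₀
  have hg : Measurable g := φ.continuousOn_symm.measurable_piecewise continuousOn_const
    φ.open_target.measurableSet
  have hφm : AEMeasurable φ (μ.restrict (φ.source ∩ M)) :=
    (φ.continuousOn.mono inter_subset_left).aemeasurable hsM.measurableSet
  have h1 : ∀ᵐ w ∂(μ.restrict (φ.source ∩ M)).map φ, g w ∉ N := by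
    have hm : MeasurableSet {w | g w ∉ N} := hg hNm.compl
    rw [ae_map_iff hφm hm, ae_restrict_iff' hsM.measurableSet]
    have hN' : ∀ᵐ x ∂μ, x ∉ N := measure_eq_zero_iff_ae_notMem.1 hN0
    filter_upwards [hN'] with x hx hxs
    simpa [g, φ.map_source hxs.1, φ.left_inv hxs.1] using hx
  have h2 := (hac φ hφ).ae_le h1
  have himg : φ '' (φ.source ∩ M) = φ.target ∩ φ.symm ⁻¹' M := φ.image_source_inter_eq' M
  have h3 : ∀ᵐ w ∂volume.restrict (φ '' (φ.source ∩ M)), g w ∉ N := h2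
  rw [himg, ae_restrict_iff' (φ.isOpen_inter_preimage_symm hM).measurableSet] at h3
  filter_upwards [h3] with w hw hwt hwM
  have := hw ⟨hwt, hwM⟩
  simp only [g, piecewise_eq_of_mem _ _ _ hwt] at this
  by_contra hcon
  exact this (subset_toMeasurable _ _ hcon)

/-- At a contact point, a potential has the same derivative as the cost function. -/
theorem fderiv_eq_of_contact {E : Type*} [NormedAddCommGroup E] [NormedSpace ℝ E] {u k : E → ℝ}
    {b : ℝ} {w : E} (hu : DifferentiableAt ℝ u w) (hk : DifferentiableAt ℝ k w)
    (hle : ∀ᶠ w' in 𝓝 w, u w' + b ≤ k w') (heq : u w + b = k w) : fderiv ℝ u w = fderiv ℝ k w := by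
  have hmin : IsLocalMin (fun w' => k w' - u w') w := by
    filter_upwards [hle] with w' hw'
    linarith
  have := hmin.hasFDerivAt_eq_zero (hk.hasFDerivAt.sub hu.hasFDerivAt)
  exact (sub_eq_zero.1 this).symm

variable [IsManifold (𝓡 d) ∞ X]

/-- On a small ball in a chart both potentials are Lipschitz. At almost every point both are
differentiable and share a contact partner `y`, so both derivatives equal that of `c(·, y)`. The
difference has zero derivative a.e. and is constant on the ball. -/
theorem eventually_sub_eq_of_ae_contact [MeasurableSpace X] [BorelSpace X]
    (hc_diff : ∀ y, MDifferentiable (𝓡 d) 𝓘(ℝ, ℝ) (fun x => c x y))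
    (hc : LocallyLipschitzUniformly d c) {μ : Measure X} {M : Set X} (hM : IsOpen M)
    (hac : LebesgueAbsolutelyContinuousInCharts d μ M) {f₁ f₂ : X → EReal}
    (hf₁ : IsCConcave c f₁) (hf₂ : IsCConcave c f₂) (hb₁ : ∀ x ∈ M, f₁ x ≠ ⊥)
    (hb₂ : ∀ x ∈ M, f₂ x ≠ ⊥)
    (hcontact : ∀ᵐ x ∂μ, ∃ y,
      (f₁ x ≠ ⊥ ∧ cTransform' c f₁ y ≠ ⊥ ∧ (f₁ x).toReal + (cTransform' c f₁ y).toReal = c x y) ∧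
      (f₂ x ≠ ⊥ ∧ cTransform' c f₂ y ≠ ⊥ ∧ (f₂ x).toReal + (cTransform' c f₂ y).toReal = c x y))
    {x : X} (hx : x ∈ M) :
    ∀ᶠ x' in 𝓝 x, (f₁ x).toReal - (f₂ x).toReal = (f₁ x').toReal - (f₂ x').toReal := by
  set φ := chartAt (EuclideanSpace ℝ (Fin d)) x
  have hxs : x ∈ φ.source := mem_chart_source _ x
  have hφ : φ ∈ atlas (EuclideanSpace ℝ (Fin d)) X := chart_mem_atlas _ x
  obtain ⟨V₁, hV₁, -, h₁⟩ := hf₁.exists_lipschitzOnWith hc hφ (φ.map_source hxs)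
  obtain ⟨V₂, hV₂, -, h₂⟩ := hf₂.exists_lipschitzOnWith hc hφ (φ.map_source hxs)
  rw [φ.left_inv hxs] at h₁ h₂
  obtain ⟨K₁, hK₁⟩ := h₁ (hb₁ x hx)
  obtain ⟨K₂, hK₂⟩ := h₂ (hb₂ x hx)
  have hW : φ.target ∩ φ.symm ⁻¹' M ∈ 𝓝 (φ x) :=
    (φ.isOpen_inter_preimage_symm hM).mem_nhds
      ⟨φ.map_source hxs, by rwa [mem_preimage, φ.left_inv hxs]⟩
  obtain ⟨r, hr, hB⟩ := Metric.mem_nhds_iff.1 (Filter.inter_mem (Filter.inter_mem hV₁ hV₂) hW)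
  set B := Metric.ball (φ x) r
  have hB₁ := hK₁.mono fun w hw => (hB hw).1.1
  have hB₂ := hK₂.mono fun w hw => (hB hw).1.2
  have hder : ∀ᵐ w, w ∈ B → HasFDerivAt
      (fun w => (f₁ (φ.symm w)).toReal - (f₂ (φ.symm w)).toReal)
      (0 : EuclideanSpace ℝ (Fin d) →L[ℝ] ℝ) w := by
    filter_upwards [hac.ae hM hφ hcontact, hB₁.ae_differentiableWithinAt_of_mem (μ := volume),
      hB₂.ae_differentiableWithinAt_of_mem (μ := volume)] with w hw hd₁ hd₂ hwB
    have hBn : B ∈ 𝓝 w := Metric.isOpen_ball.mem_nhds hwB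
    obtain ⟨y, ⟨-, hy₁, he₁⟩, ⟨-, hy₂, he₂⟩⟩ := hw (hB hwB).2.1 (hB hwB).2.2
    have hd₁ := (hd₁ hwB).differentiableAt hBn
    have hd₂ := (hd₂ hwB).differentiableAt hBn
    have hk : DifferentiableAt ℝ (fun w => c (φ.symm w) y) w := by
      rw [← mdifferentiableAt_iff_differentiableAt]
      have hs : MDifferentiableAt (𝓡 d) (𝓡 d) φ.symm w := by
        have : IsManifold (𝓡 d) 1 X := .of_le (n := ∞) (by simp)
        exact mdifferentiableAt_atlas_symm hφ (hB hwB).2.1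
      exact MDifferentiableAt.comp (I' := 𝓡 d) (g := fun x => c x y) w (hc_diff y _) hs
    have e₁ := fderiv_eq_of_contact hd₁ hk (b := (cTransform' c f₁ y).toReal) (by
      filter_upwards [hBn] with w' hw'
      exact toReal_add_toReal_le (hf₁.ne_top _) (hb₁ _ (hB hw').2.2) hy₁) he₁
    have e₂ := fderiv_eq_of_contact hd₂ hk (b := (cTransform' c f₂ y).toReal) (by
      filter_upwards [hBn] with w' hw'
      exact toReal_add_toReal_le (hf₂.ne_top _) (hb₂ _ (hB hw').2.2) hy₂) he₂
    have := hd₁.hasFDerivAt.sub hd₂.hasFDerivAt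
    rw [e₁, e₂, sub_self] at this
    exact this
  have hlip : LipschitzOnWith (K₁ + K₂)
      (fun w => (f₁ (φ.symm w)).toReal - (f₂ (φ.symm w)).toReal) B := hB₁.sub hB₂
  filter_upwards [(φ.continuousAt hxs).preimage_mem_nhds (Metric.ball_mem_nhds _ hr),
    φ.open_source.mem_nhds hxs] with x' h1 h2
  have := hlip.eq_of_ae_fderiv_eq_zero volume (convex_ball _ _) Metric.isOpen_ball hder
    (Metric.mem_ball_self hr) h1
  simpa only [φ.left_inv hxs, φ.left_inv h2] using this

end Charts

end OptimalTransport

/-! ### From local to global constancy -/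

theorem mainTheorem5 (d : ℕ) {X Y : Type*}
    [TopologicalSpace X] [PolishSpace X] [MeasurableSpace X] [BorelSpace X]
    [ChartedSpace (EuclideanSpace ℝ (Fin d)) X] [IsManifold (𝓡 d) ∞ X]
    [TopologicalSpace Y] [PolishSpace Y] [MeasurableSpace Y] [BorelSpace Y]
    (μ : Measure X) [IsProbabilityMeasure μ] (ν : Measure Y) [IsProbabilityMeasure ν]
    (c : X → Y → ℝ) (hc_nonneg : ∀ x y, 0 ≤ c x y)
    (hc_cont : Continuous (fun p : X × Y => c p.1 p.2))
    (hc_diff : ∀ y, MDifferentiable (𝓡 d) 𝓘(ℝ, ℝ) (fun x => c x y))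
    (hc_lip : OptimalTransport.LocallyLipschitzUniformly d c)
    (hT : OptimalTransport.transportCost c μ ν < ⊤)
    (hM_conn : IsConnected (interior μ.support))
    (hM_cl : closure (interior μ.support) = μ.support)
    (hM_ac : OptimalTransport.LebesgueAbsolutelyContinuousInCharts d μ (interior μ.support)) :
    OptimalTransport.PotentialsAlmostSurelyUnique c μ ν := by
  
  intro f₁ f₂ hf₁ hf₂
  -- The plan certifying `f₁` serves for `f₂` too, which yields a common partner `y`.
  obtain ⟨π, hπ, -⟩ := hf₁.2
  have hcontact := hπ.1.ae_exists ((hf₁.ae_add_eq hc_nonneg hc_cont hT hπ).and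
    (hf₂.ae_add_eq hc_nonneg hc_cont hT hπ))
  set M := interior μ.support
  have hsupp : ∀ᵐ x ∂μ, x ∈ closure M := by
    rw [hM_cl]
    exact Measure.support_mem_ae
  have hMpos : 0 < μ M := by
    obtain ⟨x, hx⟩ := hM_conn.nonempty
    exact Measure.mem_support_iff_forall x |>.1 (interior_subset hx) M
      (isOpen_interior.mem_nhds hx)
  -- Since `μ M > 0`, some point of `M` has both potentials finite; the clopen finiteness sets then
  -- contain all of `M` and its closure.
  obtain ⟨x₀, hx₀, _, ⟨hx₁, -⟩, ⟨hx₂, -⟩⟩ :=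
    (Filter.Frequently.and_eventually (frequently_ae_mem_iff.2 hMpos.ne') hcontact).exists
  have hD₁ := hf₁.1.isClopen_ne_bot hc_lip
  have hD₂ := hf₂.1.isClopen_ne_bot hc_lip
  have hs₁ := closure_minimal (hM_conn.isPreconnected.subset_isClopen hD₁ ⟨x₀, hx₀, hx₁⟩)
    hD₁.isClosed
  have hs₂ := closure_minimal (hM_conn.isPreconnected.subset_isClopen hD₂ ⟨x₀, hx₀, hx₂⟩)
    hD₂.isClosed
  set h : X → ℝ := fun x => (f₁ x).toReal - (f₂ x).toReal
  have hMconst : EqOn h (fun _ => h x₀) M := fun x hx =>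
    hM_conn.isPreconnected.induction₂ (fun x y => h x = h y)
      (fun z hz => nhdsWithin_le_nhds
        (OptimalTransport.eventually_sub_eq_of_ae_contact hc_diff hc_lip isOpen_interior hM_ac
          hf₁.1 hf₂.1 (fun x hx => hs₁ (subset_closure hx)) (fun x hx => hs₂ (subset_closure hx))
          hcontact hz))
      (fun _ _ _ _ _ _ => Eq.trans) (fun _ _ _ _ => Eq.symm) hx hx₀
  have hclconst : EqOn h (fun _ => h x₀) (closure M) :=
    hMconst.of_subset_closure (((hf₁.1.continuousOn_toReal hc_lip).mono hs₁).sub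
      ((hf₂.1.continuousOn_toReal hc_lip).mono hs₂)) continuousOn_const subset_closure
      subset_rfl
  refine ⟨h x₀, ?_⟩
  filter_upwards [hsupp] with x hx
  have hxc : h x = h x₀ := hclconst hx
  rw [← hxc, EReal.coe_sub, EReal.coe_toReal (hf₁.1.ne_top x) (hs₁ hx),
    EReal.coe_toReal (hf₂.1.ne_top x) (hs₂ hx)]
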